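/- **Model.** For $n\ge 2$ let $G$ be the complete directed graph on $n$ vertices with a start vertex $s$. An input is an integer weight assignment $\ell$ on the edges (negative weights are allowed) without negative cycles. A query/relaxation algorithm maintains values $D[v]$, initially $D[s]=0$ and $D[v]=\ell_{sv}$ for $v\neq s$. In each step it performs either a query of one of the three types - D-comparison query: "$D[u]<D[v]$?" for vertices $u,v$, - weight-comparison query: "$\ell_{uv}<\ell_{xy}$?" for edges $(u,v),(x,y)$, - edge query: "$D[u]+\ell_{uv}<D[v]$?" for an edge $(u,v)$, or a relaxation update $D[v]:=\min\{D[v],\,D[u]+\ell_{uv}\}$ for an edge $(u,v)$. A deterministic algorithm is a finite decision tree whose internal nodes are queries (with a "yes" and a "no" branch) or relaxations (with one branch) and whose leaves are relaxations. It is correct on $\ell$ if, when the computation on $\ell$ has reached and executed a leaf, every $D[v]$ equals the distance from $s$ to $v$, that is, the length of a shortest simple path. A randomized algorithm is a probability distribution on correct deterministic algorithms. The running time on $\ell$ is the number of steps (queries and relaxations) until every $D[v]$ equals the distance from $s$ to $v$. **Theorem 2.** (a) There are constants $c>0$, $C$ and $N$ such that for every $n\ge N$, every start vertex $s$ and every deterministic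 query/relaxation algorithm $\mathcal A$ on $n$ vertices that uses D-comparison, weight-comparison and edge queries together with relaxation updates, there is an integer weight assignment $\ell$ without negative cycles and with $\max_{(u,v)}|\ell_{uv}|\le Cn^4$ on which the running time of $\mathcal A$ is at least $cn^3$. It suffices that $\mathcal A$ is correct on all inputs with $\max_{(u,v)}|\ell_{uv}|\le Cn^4$. (b) There are constants $c>0$, $C$ and $N$ such that for every $n\ge N$, every start vertex $s$ and every randomized algorithm $\mathcal R$ of this kind, there is an integer weight assignment $\ell$ without negative cycles and with $\max_{(u,v)}|\ell_{uv}|\le Cn^5$ on which the expected running time of $\mathcal R$ is at least $cn^3$. It suffices that the deterministic algorithms in the support of $\mathcal R$ are correct on all inputs with $\max_{(u,v)}|\ell_{uv}|\le Cn^5$. -/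

import Mathlib

open scoped NNReal ENNReal

namespace QueryRelaxation

/-- The directed edges of the complete directed graph on `V`: ordered pairs of distinct vertices. -/
abbrev Edge (V : Type*) := (⊤ : SimpleGraph V).Dart

/-- An integer weight assignment. -/
abbrev Weights (V : Type*) := Edge V → ℤ

/-- The length of a directed walk: the sum of the weights of its edges, in the direction of travel
and with multiplicity. -/
def walkLength {V : Type*} (ℓ : Weights V) {u v : V} (p : (⊤ : SimpleGraph V).Walk u v) : ℤ :=
  (p.darts.map ℓ).sum

/-- `d` is the distance from `u` to `v`: the length of a shortest (simple) path from `u` to `v`. -/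
def IsDistance {V : Type*} (ℓ : Weights V) (u v : V) (d : ℤ) : Prop :=
  IsLeast {w : ℤ | ∃ p : (⊤ : SimpleGraph V).Walk u v, p.IsPath ∧ walkLength ℓ p = w} d

/-- There are no negative cycles. (Every closed directed walk splits into simple directed cycles,
so it is the same to ask this of closed walks.) -/
def NoNegativeCycle {V : Type*} (ℓ : Weights V) : Prop :=
  ∀ (v : V) (p : (⊤ : SimpleGraph V).Walk v v), 0 ≤ walkLength ℓ p

/-- `ℓ` is an admissible input with weights of absolute value at most `W`. -/
structure IsInput {V : Type*} (W : ℕ) (ℓ : Weights V) : Prop where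
  noNegativeCycle : NoNegativeCycle ℓ
  abs_le : ∀ e : Edge V, |ℓ e| ≤ (W : ℤ)

/-- The three types of queries. -/
inductive Query (V : Type*) where
  /-- The D-comparison query `D[u] < D[v]?` -/
  | dComparison (u v : V)
  /-- The weight-comparison query `ℓ(e) < ℓ(f)?` -/
  | weightComparison (e f : Edge V)
  /-- The edge query `D[u] + ℓ(u,v) < D[v]?`, where `e = (u,v)` -/
  | edge (e : Edge V)

/-- The outcome of a query when the current D-values are `D`. -/
def Query.answer {V : Type*} (ℓ : Weights V) (D : V → ℤ) : Query V → Bool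
  | .dComparison u v => decide (D u < D v)
  | .weightComparison e f => decide (ℓ e < ℓ f)
  | .edge e => decide (D e.fst + ℓ e < D e.snd)

/-- The relaxation update `D[v] := min {D[v], D[u] + ℓ(u,v)}` for the edge `e = (u,v)`. -/
def relaxation {V : Type*} [DecidableEq V] (ℓ : Weights V) (e : Edge V) (D : V → ℤ) : V → ℤ :=
  Function.update D e.snd (min (D e.snd) (D e.fst + ℓ e))

/-- The initial D-values: `D[s] = 0` and `D[v] = ℓ(s,v)` for `v ≠ s`. -/
def initialD {V : Type*} [DecidableEq V] (s : V) (ℓ : Weights V) (v : V) : ℤ :=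
  if h : s ≠ v then ℓ ⟨(s, v), h⟩ else 0

/-- Decision trees: an internal node is a relaxation (one branch) or a query (a "yes" branch and
a "no" branch), and a leaf is a relaxation. -/
inductive DecisionTree (V : Type*) where
  | leaf (e : Edge V)
  | relax (e : Edge V) (next : DecisionTree V)
  | query (q : Query V) (yes no : DecisionTree V)

namespace DecisionTree

variable {V : Type*} [DecidableEq V]

/-- The D-values after the first `t` steps of the computation that starts at the root with
D-values `D`. Every query and every relaxation is one step; nothing changes after the leaf. -/
def dAfter (ℓ : Weights V) : DecisionTree V → (V → ℤ) → ℕ → (V → ℤ)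
  | _, D, 0 => D
  | leaf e, D, _ + 1 => relaxation ℓ e D
  | relax e next, D, t + 1 => dAfter ℓ next (relaxation ℓ e D) t
  | query q yes no, D, t + 1 =>
      if q.answer ℓ D then dAfter ℓ yes D t else dAfter ℓ no D t

/-- The D-values at the end, once a leaf has been reached and executed. -/
def finalD (ℓ : Weights V) : DecisionTree V → (V → ℤ) → (V → ℤ)
  | leaf e, D => relaxation ℓ e D
  | relax e next, D => finalD ℓ next (relaxation ℓ e D)
  | query q yes no, D => if q.answer ℓ D then finalD ℓ yes D else finalD ℓ no D

/-- The tree is a correct single-source shortest path algorithm, with source `s`, for all inputs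
with weights of absolute value at most `W`. -/
def IsCorrect (s : V) (W : ℕ) (A : DecisionTree V) : Prop :=
  ∀ ℓ : Weights V, IsInput W ℓ → ∀ v : V, IsDistance ℓ s v (A.finalD ℓ (initialD s ℓ) v)

/-- The running time on `ℓ`: the number of steps until every D-value is the correct distance
from `s` (infinite if that never happens). -/
noncomputable def runningTime (s : V) (ℓ : Weights V) (A : DecisionTree V) : ℕ∞ :=
  ⨅ t ∈ {t : ℕ | ∀ v : V, IsDistance ℓ s v (A.dAfter ℓ (initialD s ℓ) t v)}, (t : ℕ∞)

/-- The expected running time on `ℓ` of a randomized algorithm, that is, of a probability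
distribution on decision trees. -/
noncomputable def expectedRunningTime (s : V) (ℓ : Weights V) (R : PMF (DecisionTree V)) : ℝ≥0∞ :=
  ∑' A : DecisionTree V, R A * (A.runningTime s ℓ : ℝ≥0∞)

end DecisionTree

end QueryRelaxation

/-!
The hard instances have weights `w (u, v) + φ v - φ u` with reduced weights `w ∈ [0, K]` and a
potential `φ`, a large multiple of a Sidon set. Since `w ≥ 0` there are no negative cycles. Since
distinct potentials, and distinct potential differences, are further than `K` apart, `φ` alone
decides all D-comparisons and weight-comparisons (`Separated.answer_eq`), so only edge queries and
relaxations carry information about `w`.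

The vertices are split into spokes and hubs. A hidden path alternates between them: hub `0` is `s`,
hub `j` is joined to spoke `j` by an edge of weight `0` and spoke `j` to hub `j + 1` by an edge of
weight `k`. Once hub `j` has its distance, relaxing its edges lowers every spoke that is still free,
the hidden one to its distance and all others by a little, to `K - j`. No query reveals by how much,
and before that, no spoke is low enough for its edge to hub `j + 1` to improve anything. So the
only way to recognize spoke `j` and hub `j + 1` is to query or relax the edge between them. Until
this happens the computation is the same as on the instance whose hidden path stops at hub `j`
(`IsHiddenPath.coupled_run`).

A step touches at most one edge, so for a fixed algorithm the touching times of the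
quadratically many candidate pairs of a free spoke and a free hub are distinct, and on average over
all pairs the next hub is delayed by quadratically many steps (`card_mul_le_sum`). Averaging also
over the distribution of the algorithm, some pair delays the next hub by that much in expectation.
Choosing the hidden path pair by pair in this way (`exists_isHiddenPath`), with linearly many pairs,
gives the cubic bound. A deterministic algorithm is a point mass. The potential comes from the
Erdős–Turán construction, whose entries are of order `n ^ 2`; together with `K ≤ n ^ 2` this bounds
all weights by `9 * n ^ 4`.
-/

namespace QueryRelaxation

variable {V : Type*} [DecidableEq V]

/-! ### Step-by-step execution -/

namespace DecisionTree

/-- One step of the computation. A configuration consists of the subtree that is still to be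
executed (`none` after the leaf) and of the current D-values. -/
def step (ℓ : Weights V) :
    Option (DecisionTree V) × (V → ℤ) → Option (DecisionTree V) × (V → ℤ)
  | (none, D) => (none, D)
  | (some (leaf e), D) => (none, relaxation ℓ e D)
  | (some (relax e next), D) => (some next, relaxation ℓ e D)
  | (some (query q yes no), D) => (if q.answer ℓ D then some yes else some no, D)

/-- The edge that the next step queries or relaxes, if it does so for a single edge. -/
def touched : Option (DecisionTree V) → Option (Edge V)
  | some (leaf e) => some e
  | some (relax e _) => some e
  | some (query (.edge e) _ _) => some e
  | _ => none

/-- The configuration after `t` steps of the algorithm `A` with source `s` on the input `ℓ`. -/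
def run (s : V) (ℓ : Weights V) (A : DecisionTree V) (t : ℕ) :
    Option (DecisionTree V) × (V → ℤ) :=
  (step ℓ)^[t] (some A, initialD s ℓ)

theorem run_succ (s : V) (ℓ : Weights V) (A : DecisionTree V) (t : ℕ) :
    run s ℓ A (t + 1) = step ℓ (run s ℓ A t) :=
  Function.iterate_succ_apply' _ _ _

theorem step_iterate_none (ℓ : Weights V) (D : V → ℤ) (t : ℕ) :
    (step ℓ)^[t] (none, D) = (none, D) :=
  Function.iterate_fixed rfl t

theorem step_iterate_snd (ℓ : Weights V) (A : DecisionTree V) (D : V → ℤ) (t : ℕ) :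
    ((step ℓ)^[t] (some A, D)).2 = dAfter ℓ A D t := by
  induction t generalizing A D with
  | zero => cases A <;> rfl
  | succ t ih =>
    rw [Function.iterate_succ_apply]
    cases A with
    | leaf e => simp [step, step_iterate_none, dAfter]
    | relax e next => simp [step, ih, dAfter]
    | query q yes no =>
      by_cases h : q.answer ℓ D = true <;> simp [step, dAfter, h, ih]

theorem run_snd (s : V) (ℓ : Weights V) (A : DecisionTree V) (t : ℕ) :
    (run s ℓ A t).2 = dAfter ℓ A (initialD s ℓ) t :=
  step_iterate_snd _ _ _ _

end DecisionTree

/-! ### Potentials -/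

/-- The weights with reduced weights `w` with respect to the potential `φ`. -/
def shift (φ : V → ℤ) (w : Weights V) : Weights V := fun e => w e + (φ e.snd - φ e.fst)

/-- The D-values for the weights `shift φ w` that correspond to the D-values `d` for `w`. -/
def lift (φ : V → ℤ) (s : V) (d : V → ℤ) : V → ℤ := fun v => d v + (φ v - φ s)

theorem initialD_shift (φ : V → ℤ) (s : V) (w : Weights V) :
    initialD s (shift φ w) = lift φ s (initialD s w) := by
  funext v
  by_cases h : s = v
  · subst h; simp [initialD, lift]
  · simp [initialD, lift, shift, h]

theorem relaxation_shift (φ : V → ℤ) (s : V) (w : Weights V) (e : Edge V) (d : V → ℤ) :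
    relaxation (shift φ w) e (lift φ s d) = lift φ s (relaxation w e d) := by
  funext v
  by_cases h : v = e.snd
  · subst h
    simp only [relaxation, lift, shift, Function.update_self]
    omega
  · simp [relaxation, lift, h]

theorem answer_edge_shift {V : Type*} (φ : V → ℤ) (s : V) (w : Weights V) (e : Edge V) (d : V → ℤ) :
    (Query.edge e).answer (shift φ w) (lift φ s d) = decide (d e.fst + w e < d e.snd) := by
  simp only [Query.answer, lift, shift]
  exact decide_eq_decide.2 (by omega)

theorem walkLength_shift {V : Type*} (φ : V → ℤ) (w : Weights V) {u v : V}
    (p : (⊤ : SimpleGraph V).Walk u v) :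
    walkLength (shift φ w) p = walkLength w p + (φ v - φ u) := by
  induction p with
  | nil => simp [walkLength]
  | cons h p ih =>
    simp only [walkLength, SimpleGraph.Walk.darts_cons, List.map_cons, List.sum_cons] at ih ⊢
    rw [ih]
    simp only [shift]
    omega

theorem walkLength_nonneg {V : Type*} {w : Weights V} (hw : ∀ e, 0 ≤ w e) {u v : V}
    (p : (⊤ : SimpleGraph V).Walk u v) : 0 ≤ walkLength w p :=
  List.sum_nonneg (by simp only [List.mem_map]; rintro _ ⟨e, -, rfl⟩; exact hw e)

/-- Potential differences of distinct edges, and potentials of distinct vertices, are more than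
`K` apart. Reduced weights and reduced D-values in `[0, K]` then have no influence on
D-comparisons and weight-comparisons. -/
structure Separated (φ : V → ℤ) (K : ℤ) : Prop where
  edges : ∀ e f : Edge V, e ≠ f → K < |(φ e.snd - φ e.fst) - (φ f.snd - φ f.fst)|
  vertices : ∀ u v : V, u ≠ v → K < |φ u - φ v|

/-! ### The hard instances -/

/-- The largest reduced weight that occurs; it is also the reduced D-value of every vertex that
has never been improved. -/
def cap (k : ℕ) : ℤ := k * (k + 1)

/-- The reduced weight of the edge `(u, v)` in the instance that the labelling `lab` describes.
The vertices of `X` are the spokes, all others the hubs. The labelled vertices form a hidden path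
`hub 0, spoke 0, hub 1, spoke 1, …`. The edge from spoke `j` to hub `j + 1` costs `k` and the edge
from hub `j` to spoke `j` is free, whereas the edge from hub `j` to any other spoke lowers the
value of that spoke to `cap k - j` only. All other edges are too long to matter. -/
def hiddenWeight (X : Finset V) (k : ℕ) (lab : V → Option ℕ) (u v : V) : ℤ :=
  if u ∉ X ∧ v ∈ X then
    match lab u with
    | none => cap k
    | some j => if lab v = some j then 0 else cap k - j * (k + 1)
  else if u ∈ X ∧ v ∉ X then
    match lab u with
    | none => cap k
    | some j => if lab v = some (j + 1) then k else cap k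
  else cap k

/-- `hiddenWeight` as a weight assignment. -/
def hiddenWeights (X : Finset V) (k : ℕ) (lab : V → Option ℕ) : Weights V :=
  fun e => hiddenWeight X k lab e.fst e.snd

/-- The labelling `lab` describes a hidden path with `t` spokes, from hub `0`, which is `s`, to
hub `t`, which is `c`. -/
structure IsHiddenPath (X : Finset V) (s : V) (t : ℕ) (lab : V → Option ℕ) (c : V) : Prop where
  source_notMem : s ∉ X
  lab_source : lab s = some 0
  spoke_lt : ∀ v ∈ X, ∀ j, lab v = some j → j < t
  hub_le : ∀ v ∉ X, ∀ j, lab v = some j → j ≤ t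
  end_notMem : c ∉ X
  lab_end : lab c = some t
  end_unique : ∀ v ∉ X, lab v = some t → v = c

/-- The labelling after the hidden path with `t` spokes is extended by the spoke `x` and the
hub `y`. -/
def extendLabels (lab : V → Option ℕ) (t : ℕ) (x y : V) : V → Option ℕ :=
  Function.update (Function.update lab x (some t)) y (some (t + 1))

theorem IsHiddenPath.extend {X : Finset V} {s : V} {t : ℕ} {lab : V → Option ℕ} {c x y : V}
    (h : IsHiddenPath X s t lab c) (hx : x ∈ X) (hy : y ∉ X) (hlx : lab x = none)
    (hly : lab y = none) : IsHiddenPath X s (t + 1) (extendLabels lab t x y) y := by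
  have hsy : s ≠ y := by rintro rfl; simp [h.lab_source] at hly
  have hsx : s ≠ x := by rintro rfl; simp [h.lab_source] at hlx
  refine ⟨h.source_notMem, ?_, ?_, ?_, hy, ?_, ?_⟩
  · simp [extendLabels, hsy, hsx, h.lab_source]
  · intro v hv j hj
    have hvy : v ≠ y := by rintro rfl; exact hy hv
    by_cases hvx : v = x
    · subst hvx; simp [extendLabels, hvy] at hj; omega
    · simp only [extendLabels, Function.update_of_ne hvy, Function.update_of_ne hvx] at hj
      have := h.spoke_lt v hv j hj
      omega
  · intro v hv j hj
    have hvx : v ≠ x := by rintro rfl; exact hv hx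
    by_cases hvy : v = y
    · subst hvy; simp [extendLabels] at hj; omega
    · simp only [extendLabels, Function.update_of_ne hvy, Function.update_of_ne hvx] at hj
      have := h.hub_le v hv j hj
      omega
  · simp [extendLabels]
  · intro v hv hj
    have hvx : v ≠ x := by rintro rfl; exact hv hx
    by_contra hvy
    simp only [extendLabels, Function.update_of_ne hvy, Function.update_of_ne hvx] at hj
    have := h.hub_le v hv _ hj
    omega

/-- The edges of reduced weight less than `cap k`. -/
theorem hiddenWeight_cases (X : Finset V) (k : ℕ) (lab : V → Option ℕ) (u v : V) :
    hiddenWeight X k lab u v = cap k ∨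
    (∃ j, u ∉ X ∧ v ∈ X ∧ lab u = some j ∧ lab v = some j ∧ hiddenWeight X k lab u v = 0) ∨
    (∃ j, u ∉ X ∧ v ∈ X ∧ lab u = some j ∧ lab v ≠ some j ∧
      hiddenWeight X k lab u v = cap k - j * (k + 1)) ∨
    (∃ j, u ∈ X ∧ v ∉ X ∧ lab u = some j ∧ lab v = some (j + 1) ∧
      hiddenWeight X k lab u v = k) := by
  unfold hiddenWeight
  by_cases hu : u ∈ X <;> by_cases hv : v ∈ X <;> cases hlu : lab u <;> simp [hu, hv] <;> grind

theorem IsHiddenPath.hiddenWeight_mem {X : Finset V} {s : V} {t k : ℕ} {lab : V → Option ℕ} {c : V}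
    (h : IsHiddenPath X s t lab c) (htk : t ≤ k) (u v : V) :
    0 ≤ hiddenWeight X k lab u v ∧ hiddenWeight X k lab u v ≤ cap k := by
  have hk : (k : ℤ) ≤ cap k := by unfold cap; nlinarith
  rcases hiddenWeight_cases X k lab u v with h1 | ⟨j, h1, h2, h3, h4, h5⟩ |
    ⟨j, h1, h2, h3, h4, h5⟩ | ⟨j, h1, h2, h3, h4, h5⟩
  · rw [h1]; omega
  · rw [h5]; omega
  · have hj : (j : ℤ) ≤ k := by exact_mod_cast (h.hub_le u h1 j h3).trans htk
    rw [h5]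
    have : (j : ℤ) * (k + 1) ≤ cap k := by unfold cap; gcongr
    have : 0 ≤ (j : ℤ) * (k + 1) := by positivity
    omega
  · rw [h5]; omega

/-- The reduced D-values `d` are among those that can occur on the instance of a hidden path with
`t` spokes. A hub or spoke on the path may have reached its distance, and otherwise has still a
large value. -/
structure Reachable (X : Finset V) (k t : ℕ) (lab : V → Option ℕ) (d : V → ℤ) : Prop where
  le_cap : ∀ v, d v ≤ cap k
  hub_none : ∀ v ∉ X, lab v = none → d v = cap k
  hub_some : ∀ v ∉ X, ∀ j, lab v = some j → d v = j * k ∨ d v = cap k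
  spoke_none : ∀ v ∈ X, lab v = none → cap k - t ≤ d v
  spoke_some : ∀ v ∈ X, ∀ j, lab v = some j → d v = j * k ∨ cap k - k ≤ d v

theorem Reachable.nonneg {X : Finset V} {k t : ℕ} {lab : V → Option ℕ} {d : V → ℤ}
    (hd : Reachable X k t lab d) (htk : t ≤ k) (v : V) : 0 ≤ d v := by
  have hk : (k : ℤ) ≤ cap k := by unfold cap; nlinarith
  have htk' : (t : ℤ) ≤ k := by exact_mod_cast htk
  by_cases hv : v ∈ X <;> cases hl : lab v with
  | none => first
    | (have := hd.spoke_none v hv hl; omega)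
    | (have := hd.hub_none v hv hl; omega)
  | some j =>
    have hj : 0 ≤ (j : ℤ) * k := by positivity
    first
    | (have := hd.spoke_some v hv j hl; omega)
    | (have := hd.hub_some v hv j hl; omega)

theorem IsHiddenPath.reachable_initialD {X : Finset V} {s : V} {t k : ℕ} {lab : V → Option ℕ}
    {c : V} (h : IsHiddenPath X s t lab c) :
    Reachable X k t lab (initialD s (hiddenWeights X k lab)) := by
  have hval : ∀ v, v ≠ s → initialD s (hiddenWeights X k lab) v =
      if v ∈ X then (if lab v = some 0 then 0 else cap k) else cap k := by
    intro v hv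
    have h1 := h.source_notMem
    simp only [initialD, hv.symm, ne_eq, not_false_eq_true, dite_true, hiddenWeights, hiddenWeight]
    by_cases hvX : v ∈ X <;> simp [h1, hvX, h.lab_source]
  have hs : initialD s (hiddenWeights X k lab) s = 0 := by simp [initialD]
  have hk : 0 ≤ cap k := by unfold cap; positivity
  refine ⟨fun v => ?_, fun v hv hl => ?_, fun v hv j hl => ?_, fun v hv hl => ?_,
    fun v hv j hl => ?_⟩ <;> by_cases hvs : v = s
  · subst hvs; omega
  · rw [hval v hvs]; split_ifs <;> omega
  · subst hvs; simp [h.lab_source] at hl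
  · simp [hval v hvs, hv]
  · subst hvs
    simp only [h.lab_source, Option.some.injEq] at hl
    subst hl
    simp [hs]
  · simp [hval v hvs, hv]
  · subst hvs; exact absurd hv h.source_notMem
  · simp [hval v hvs, hv, hl]
  · subst hvs; exact absurd hv h.source_notMem
  · rw [hval v hvs, if_pos hv, hl]
    by_cases hj : j = 0 <;> simp [hj]

theorem IsHiddenPath.reachable_relaxation {X : Finset V} {s : V} {t k : ℕ} {lab : V → Option ℕ}
    {c : V} (h : IsHiddenPath X s t lab c) (htk : t ≤ k) {d : V → ℤ}
    (hd : Reachable X k t lab d) (e : Edge V) :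
    Reachable X k t lab (relaxation (hiddenWeights X k lab) e d) := by
  obtain ⟨⟨u, v⟩, huv⟩ := e
  simp only [relaxation, hiddenWeights]
  by_cases hle : d v ≤ d u + hiddenWeight X k lab u v
  · rw [min_eq_left hle, Function.update_eq_self]; exact hd
  rw [min_eq_right (not_le.1 hle).le]
  have hu0 := hd.nonneg htk u
  have hvK := hd.le_cap v
  have htk' : (t : ℤ) ≤ k := by exact_mod_cast htk
  -- It suffices to check the new value of `v`.
  suffices H : (v ∈ X → lab v = none → cap k - t ≤ d u + hiddenWeight X k lab u v) ∧
      (∀ j : ℕ, lab v = some j → d u + hiddenWeight X k lab u v = j * k ∨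
        (v ∈ X ∧ cap k - k ≤ d u + hiddenWeight X k lab u v)) ∧ (v ∉ X → lab v ≠ none) by
    obtain ⟨H1, H2, H3⟩ := H
    refine ⟨fun z => ?_, fun z hz hl => ?_, fun z hz j hl => ?_, fun z hz hl => ?_,
      fun z hz j hl => ?_⟩ <;> by_cases hzv : z = v
    · subst hzv; simp; omega
    · simpa [hzv] using hd.le_cap z
    · subst hzv; exact absurd hl (H3 hz)
    · simpa [hzv] using hd.hub_none z hz hl
    · subst hzv
      have := H2 j hl
      simp only [hz, false_and, or_false] at this
      simp [this]
    · simpa [hzv] using hd.hub_some z hz j hl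
    · subst hzv; simpa using H1 hz hl
    · simpa [hzv] using hd.spoke_none z hz hl
    · subst hzv; simpa [hz] using H2 j hl
    · simpa [hzv] using hd.spoke_some z hz j hl
  rcases hiddenWeight_cases X k lab u v with h1 | ⟨j, h1, h2, h3, h4, h5⟩ |
    ⟨j, h1, h2, h3, h4, h5⟩ | ⟨j, h1, h2, h3, h4, h5⟩
  · omega
  · rw [h5] at hle ⊢
    have : d u = j * k := by rcases hd.hub_some u h1 j h3 with h | h <;> omega
    simp [h4, h2, this]
  · have hw := (h.hiddenWeight_mem htk u v).1
    have hdu : d u = j * k := by rcases hd.hub_some u h1 j h3 with h | h <;> omega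
    have hjt : (j : ℤ) ≤ t := by exact_mod_cast h.hub_le u h1 j h3
    have hnew : d u + hiddenWeight X k lab u v = cap k - j := by rw [h5, hdu]; ring
    rw [hnew]
    refine ⟨fun _ _ => by omega, fun i _ => Or.inr ⟨h2, by omega⟩, fun h => absurd h2 h⟩
  · have hdu : d u = j * k := by rcases hd.spoke_some u h1 j h3 with h | h <;> omega
    have hnew : d u + hiddenWeight X k lab u v = (j + 1) * k := by rw [h5, hdu]; ring
    rw [hnew]
    simp [h2, h4]

/-! ### Extending the hidden path -/

/-- The reduced D-values `d` on the instance of a hidden path with `t` spokes and end `c`, and the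
reduced D-values `d'` on the instance in which the path is extended by the spoke `x`, agree, except
that `x` has its true distance in `d'` once it has been relaxed from `c`. -/
structure Coupled (k t : ℕ) (c x : V) (d d' : V → ℤ) : Prop where
  eq_of_ne : ∀ v, v ≠ x → d' v = d v
  spoke : (d' x = d x ∧ cap k - t < d x) ∨ (d c < cap k ∧ d x = cap k - t ∧ d' x = t * k)

theorem mul_lt_cap_sub {k t : ℕ} (htk : t < k) : (t : ℤ) * k < cap k - t := by
  have : (t : ℤ) + 1 ≤ k := by exact_mod_cast htk
  unfold cap
  nlinarith

section Extension

variable {X : Finset V} {s c x y : V} {t k : ℕ} {lab : V → Option ℕ}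

theorem extendLabels_of_ne {v : V} (hvx : v ≠ x) (hvy : v ≠ y) :
    extendLabels lab t x y v = lab v := by
  simp [extendLabels, hvx, hvy]

/-- The extension of the hidden path from `c` by `x` and `y` changes the weights of `(c, x)` and
`(x, y)` and of edges that leave `y`, and of no other edges. -/
theorem IsHiddenPath.hiddenWeight_extend (h : IsHiddenPath X s t lab c) (hx : x ∈ X) (hy : y ∉ X)
    (hlx : lab x = none) (hly : lab y = none) {u v : V} (huy : u ≠ y)
    (hcx : ¬(u = c ∧ v = x)) (hxy : ¬(u = x ∧ v = y)) :
    hiddenWeight X k (extendLabels lab t x y) u v = hiddenWeight X k lab u v := by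
  have hne : x ≠ y := by rintro rfl; exact hy hx
  by_cases hux : u = x
  · subst hux
    by_cases hvX : v ∈ X
    · simp [hiddenWeight, hx, hvX]
    · have hvu : v ≠ u := by rintro rfl; exact hvX hx
      have hvy : v ≠ y := fun h => hxy ⟨rfl, h⟩
      have h1 : lab v ≠ some (t + 1) := fun h2 => by have := h.hub_le v hvX _ h2; omega
      have h2 : extendLabels lab t u y u = some t := by simp [extendLabels, hne]
      simp [hiddenWeight, hx, hvX, hlx, h2, extendLabels_of_ne hvu hvy, h1]
  by_cases hvx : v = x
  · subst hvx
    by_cases huX : u ∈ X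
    · simp [hiddenWeight, hx, huX]
    · have h1 : lab u ≠ some t := fun h2 => hcx ⟨h.end_unique u huX h2, rfl⟩
      have h2 : extendLabels lab t v y v = some t := by simp [extendLabels, hne]
      simp only [hiddenWeight, huX, hx, extendLabels_of_ne hux huy, h2, hlx]
      cases hl : lab u with
      | none => simp
      | some j =>
        have : t ≠ j := by rintro rfl; exact h1 hl
        simp [this]
  by_cases hvy : v = y
  · subst hvy
    by_cases huX : u ∈ X
    · have h1 : lab u ≠ some t := fun h2 => by have := h.spoke_lt u huX _ h2; omega
      have h2 : extendLabels lab t x v v = some (t + 1) := by simp [extendLabels]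
      simp only [hiddenWeight, huX, hy, extendLabels_of_ne hux huy, h2, hly]
      cases hl : lab u with
      | none => simp
      | some j =>
        have : t ≠ j := by rintro rfl; exact h1 hl
        simp [this]
    · simp [hiddenWeight, huX, hy]
  · simp [hiddenWeight, extendLabels_of_ne hux huy, extendLabels_of_ne hvx hvy]

/-- On the two instances an edge other than `(x, y)` either improves neither or both of the coupled
D-values, and the new values are coupled again. The same is true of `(x, y)` as long as `c`
has not been improved. -/
theorem IsHiddenPath.coupled_edge (h : IsHiddenPath X s t lab c) (htk : t < k) (hx : x ∈ X)
    (hy : y ∉ X) (hlx : lab x = none) (hly : lab y = none) {d d' : V → ℤ}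
    (hd : Reachable X k t lab d) (hdd : Coupled k t c x d d') {u v : V} (huv : u ≠ v)
    (hxy : ¬((u = x ∧ v = y) ∧ d c < cap k)) :
    (d v ≤ d u + hiddenWeight X k lab u v ∧
      d' v ≤ d' u + hiddenWeight X k (extendLabels lab t x y) u v) ∨
    ((d u + hiddenWeight X k lab u v < d v ∧
      d' u + hiddenWeight X k (extendLabels lab t x y) u v < d' v) ∧
      ((d' u + hiddenWeight X k (extendLabels lab t x y) u v = d u + hiddenWeight X k lab u v ∧
        (v = x → cap k - t < d u + hiddenWeight X k lab u v)) ∨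
      (v = x ∧ d c < cap k ∧ d u + hiddenWeight X k lab u v = cap k - t ∧
        d' u + hiddenWeight X k (extendLabels lab t x y) u v = t * k))) := by
  have hne : x ≠ y := by rintro rfl; exact hy hx
  have hcx : c ≠ x := by rintro rfl; exact h.end_notMem hx
  have hcy : c ≠ y := by rintro rfl; simp [h.lab_end] at hly
  have hext := h.extend hx hy hlx hly
  have hlt := mul_lt_cap_sub htk
  have htk' : (t : ℤ) < k := by exact_mod_cast htk
  have htk0 : 0 ≤ (t : ℤ) * k := by positivity
  have hw := h.hiddenWeight_mem (k := k) htk.le u v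
  have hw' := hext.hiddenWeight_mem (k := k) htk u v
  have hd0 : ∀ z, 0 ≤ d z := hd.nonneg htk.le
  have hdK := hd.le_cap
  have hdy : d y = cap k := hd.hub_none y hy hly
  have hdx : cap k - t ≤ d x := hd.spoke_none x hx hlx
  have hd'0 : 0 ≤ d' x ∧ d' x ≤ d x := by
    rcases hdd.spoke with ⟨h1, h2⟩ | ⟨h1, h2, h3⟩ <;> have := hd0 x <;> omega
  have hd'v : d' v ≤ cap k := by
    by_cases hvx : v = x
    · subst hvx; have := hdK v; omega
    · rw [hdd.eq_of_ne v hvx]; exact hdK v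
  by_cases huy : u = y
  · -- An edge that leaves `y` improves nothing because `y` has the largest possible value.
    subst huy
    left
    have := hdd.eq_of_ne u hne.symm
    have := hdK v
    omega
  by_cases hux : u = x
  · subst hux
    left
    have hwuv : hiddenWeight X k lab u v = cap k := by
      rcases hiddenWeight_cases X k lab u v with h1 | ⟨j, h1, h2, h3, h4, h5⟩ |
        ⟨j, h1, h2, h3, h4, h5⟩ | ⟨j, h1, h2, h3, h4, h5⟩ <;> simp_all
    have := hdK v
    have := hd0 u
    by_cases hvy : v = y
    · subst hvy
      have hc : d' u = d u := by
        rcases hdd.spoke with ⟨h1, h2⟩ | ⟨h1, h2, h3⟩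
        · exact h1
        · exact absurd ⟨⟨rfl, rfl⟩, h1⟩ hxy
      have hw2 : hiddenWeight X k (extendLabels lab t u v) u v = k := by
        simp [hiddenWeight, hx, hy, extendLabels, hne]
      omega
    · rw [h.hiddenWeight_extend hx hy hlx hly huy (fun h => huv (h.1.trans (h.1 ▸ h.2.symm)))
        (fun h => hvy h.2)]
      omega
  have hduu := hdd.eq_of_ne u hux
  by_cases hcase : u = c ∧ v = x
  · obtain ⟨rfl, rfl⟩ := hcase
    have hu := h.end_notMem
    have hlv : extendLabels lab t v y v = some t := by simp [extendLabels, hne]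
    have hw1 : hiddenWeight X k lab u v = cap k - t * (k + 1) := by
      simp [hiddenWeight, hu, hx, h.lab_end, hlx]
    have hw2 : hiddenWeight X k (extendLabels lab t v y) u v = 0 := by
      simp [hiddenWeight, hu, hx, extendLabels_of_ne hux huy, h.lab_end, hlv]
    have := hdK v
    rcases hd.hub_some u hu t h.lab_end with hdu | hdu
    · have hnew : d u + hiddenWeight X k lab u v = cap k - t := by rw [hw1, hdu]; ring
      rw [hnew, hw2, hduu, hdu]
      rcases hdd.spoke with ⟨h1, h2⟩ | ⟨h1, h2, h3⟩
      · right
        exact ⟨by omega, Or.inr ⟨rfl, by omega, rfl, by omega⟩⟩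
      · left; omega
    · left; omega
  · rw [h.hiddenWeight_extend hx hy hlx hly huy hcase (fun h => hux h.1), hduu]
    by_cases hvx : v = x
    · -- Only hubs before `c` remain, and they lower `x` to a value above `cap k - t`.
      subst hvx
      have hnew : d u + hiddenWeight X k lab u v < d v →
          cap k - t < d u + hiddenWeight X k lab u v := by
        intro hlt'
        have := hdK v
        have := hd0 u
        rcases hiddenWeight_cases X k lab u v with h1 | ⟨j, h1, h2, h3, h4, h5⟩ |
          ⟨j, h1, h2, h3, h4, h5⟩ | ⟨j, h1, h2, h3, h4, h5⟩
        · omega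
        · simp [hlx] at h4
        · have hdu : d u = j * k := by rcases hd.hub_some u h1 j h3 with h | h <;> omega
          have hjt : j < t := lt_of_le_of_ne (h.hub_le u h1 j h3) (by
            rintro rfl; exact hcase ⟨h.end_unique u h1 h3, rfl⟩)
          have : d u + hiddenWeight X k lab u v = cap k - j := by rw [h5, hdu]; ring
          omega
        · exact absurd hx h2
      by_cases hle : d v ≤ d u + hiddenWeight X k lab u v
      · left
        omega
      · right
        have := hnew (not_le.1 hle)
        rcases hdd.spoke with ⟨h1, h2⟩ | ⟨h1, h2, h3⟩
        · exact ⟨by omega, Or.inl ⟨rfl, fun _ => this⟩⟩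
        · omega
    · rw [hdd.eq_of_ne v hvx]
      by_cases hle : d v ≤ d u + hiddenWeight X k lab u v
      · exact Or.inl ⟨hle, hle⟩
      · exact Or.inr ⟨⟨not_le.1 hle, not_le.1 hle⟩, Or.inl ⟨rfl, fun h => absurd h hvx⟩⟩

theorem IsHiddenPath.coupled_relaxation (h : IsHiddenPath X s t lab c) (htk : t < k) (hx : x ∈ X)
    (hy : y ∉ X) (hlx : lab x = none) (hly : lab y = none) {d d' : V → ℤ}
    (hd : Reachable X k t lab d) (hdd : Coupled k t c x d d') (e : Edge V)
    (hxy : ¬((e.fst = x ∧ e.snd = y) ∧ d c < cap k)) :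
    Coupled k t c x (relaxation (hiddenWeights X k lab) e d)
      (relaxation (hiddenWeights X k (extendLabels lab t x y)) e d') := by
  have hcx : c ≠ x := by rintro rfl; exact h.end_notMem hx
  obtain ⟨⟨u, v⟩, huv⟩ := e
  have hstep := h.coupled_edge htk hx hy hlx hly hd hdd (u := u) (v := v)
    (by simpa using huv) hxy
  simp only [relaxation, hiddenWeights]
  rcases hstep with ⟨h1, h2⟩ | ⟨⟨h1, h2⟩, h3⟩
  · rw [min_eq_left h1, min_eq_left h2, Function.update_eq_self, Function.update_eq_self]
    exact hdd
  rw [min_eq_right h1.le, min_eq_right h2.le]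
  rcases h3 with ⟨h3, h4⟩ | ⟨rfl, h3, h4, h5⟩
  · rw [h3]
    refine ⟨fun z hz => ?_, ?_⟩
    · by_cases hzv : z = v
      · subst hzv; simp
      · simpa [hzv] using hdd.eq_of_ne z hz
    · by_cases hxv : x = v
      · subst hxv; left; simpa using h4 rfl
      · rcases hdd.spoke with h | ⟨h6, h7⟩
        · left; simpa [hxv] using h
        · right
          simp only [Function.update_of_ne hxv]
          refine ⟨?_, h7⟩
          -- The value of `c` can only have decreased.
          by_cases hcv : c = v
          · subst hcv; simp; omega
          · simpa [hcv] using h6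
  · rw [h4, h5]
    refine ⟨fun z hz => ?_, Or.inr ?_⟩
    · simpa [hz] using hdd.eq_of_ne z hz
    · simpa [hcx] using h3

theorem IsHiddenPath.coupled_initialD (h : IsHiddenPath X s t lab c) (htk : t < k) (hx : x ∈ X)
    (hy : y ∉ X) (hlx : lab x = none) (hly : lab y = none) :
    Coupled k t c x (initialD s (hiddenWeights X k lab))
      (initialD s (hiddenWeights X k (extendLabels lab t x y))) := by
  have hsy : s ≠ y := by rintro rfl; simp [h.lab_source] at hly
  have hsx : s ≠ x := by rintro rfl; simp [h.lab_source] at hlx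
  have hs := h.source_notMem
  have hne : x ≠ y := by rintro rfl; exact hy hx
  have hlt := mul_lt_cap_sub htk
  have hk : 0 < cap k := by have : 0 ≤ (t : ℤ) * k := by positivity
                            omega
  refine ⟨fun v hv => ?_, ?_⟩
  · by_cases hvs : s = v
    · simp [initialD, hvs]
    · simp only [initialD, hvs, ne_eq, not_false_eq_true, dite_true, hiddenWeights]
      exact h.hiddenWeight_extend hx hy hlx hly hsy (fun h => hv h.2) (fun h => hsx h.1)
  · have hlx' : extendLabels lab t x y x = some t := by simp [extendLabels, hne]
    have h1 : initialD s (hiddenWeights X k lab) x = cap k := by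
      simp [initialD, hsx, hiddenWeights, hiddenWeight, hs, hx, h.lab_source, hlx]
    have h2 : initialD s (hiddenWeights X k (extendLabels lab t x y)) x =
        if t = 0 then 0 else cap k := by
      simp [initialD, hsx, hiddenWeights, hiddenWeight, hs, hx, extendLabels_of_ne hsx hsy,
        h.lab_source, hlx']
    rw [h1, h2]
    by_cases ht : t = 0
    · subst ht
      have hsc := h.end_unique s hs h.lab_source
      right
      subst hsc
      simpa [initialD] using hk
    · left
      rw [if_neg ht]
      omega

/-- D-comparison and weight-comparison queries are answered by the potential alone. -/
theorem Separated.answer_eq {φ : V → ℤ} {K : ℤ} (hφ : Separated φ K) (s : V) {w w' : Weights V}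
    {d d' : V → ℤ} (hw : ∀ e, 0 ≤ w e ∧ w e ≤ K) (hw' : ∀ e, 0 ≤ w' e ∧ w' e ≤ K)
    (hd : ∀ v, 0 ≤ d v ∧ d v ≤ K) (hd' : ∀ v, 0 ≤ d' v ∧ d' v ≤ K) (q : Query V)
    (hq : ∀ e, q ≠ .edge e) :
    q.answer (shift φ w') (lift φ s d') = q.answer (shift φ w) (lift φ s d) := by
  cases q with
  | edge e => exact absurd rfl (hq e)
  | dComparison u v =>
    simp only [Query.answer, lift]
    refine decide_eq_decide.2 ?_
    by_cases huv : u = v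
    · simp [huv]
    · have := hφ.vertices u v huv
      have := hd u; have := hd v; have := hd' u; have := hd' v
      rcases lt_abs.1 ‹K < |_|› with h | h <;> constructor <;> intro <;> omega
  | weightComparison e f =>
    simp only [Query.answer, shift]
    refine decide_eq_decide.2 ?_
    by_cases hef : e = f
    · simp [hef]
    · have := hφ.edges e f hef
      have := hw e; have := hw f; have := hw' e; have := hw' f
      rcases lt_abs.1 ‹K < |_|› with h | h <;> constructor <;> intro <;> omega

open DecisionTree in
/-- As long as the edge `(x, y)` has not been touched after an improvement of `c`, the computations
on the two instances visit the same nodes. -/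
theorem IsHiddenPath.coupled_run (h : IsHiddenPath X s t lab c) (htk : t < k) (hx : x ∈ X)
    (hy : y ∉ X) (hlx : lab x = none) (hly : lab y = none) {φ : V → ℤ} (hφ : Separated φ (cap k))
    (A : DecisionTree V) (T : ℕ)
    (hT : ∀ i < T, ∀ e, touched (run s (shift φ (hiddenWeights X k lab)) A i).1 = some e →
      e.fst = x → e.snd = y →
      lift φ s (fun _ => cap k) c ≤ (run s (shift φ (hiddenWeights X k lab)) A i).2 c) :
    (run s (shift φ (hiddenWeights X k (extendLabels lab t x y))) A T).1 =
      (run s (shift φ (hiddenWeights X k lab)) A T).1 ∧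
    ∃ d d', (run s (shift φ (hiddenWeights X k lab)) A T).2 = lift φ s d ∧
      (run s (shift φ (hiddenWeights X k (extendLabels lab t x y))) A T).2 = lift φ s d' ∧
      Reachable X k t lab d ∧ Coupled k t c x d d' := by
  induction T with
  | zero =>
    exact ⟨rfl, _, _, initialD_shift _ _ _, initialD_shift _ _ _, h.reachable_initialD,
      h.coupled_initialD htk hx hy hlx hly⟩
  | succ T ih =>
    obtain ⟨hnode, d, d', hrd, hrd', hd, hdd⟩ := ih fun i hi => hT i (by omega)
    have hTT := hT T (by omega)
    rw [run_succ, run_succ]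
    generalize run s (shift φ (hiddenWeights X k lab)) A T = ρ at *
    generalize run s (shift φ (hiddenWeights X k (extendLabels lab t x y))) A T = ρ' at *
    obtain ⟨n, D⟩ := ρ
    obtain ⟨n', D'⟩ := ρ'
    simp only at hnode hrd hrd' hTT
    subst hnode hrd hrd'
    simp only [lift, add_le_add_iff_right] at hTT
    have hrelax : ∀ e, touched n' = some e →
        ∃ d₁ d₁', relaxation (shift φ (hiddenWeights X k lab)) e (lift φ s d) = lift φ s d₁ ∧
          relaxation (shift φ (hiddenWeights X k (extendLabels lab t x y))) e (lift φ s d') =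
            lift φ s d₁' ∧
          Reachable X k t lab d₁ ∧ Coupled k t c x d₁ d₁' := by
      intro e he
      refine ⟨_, _, relaxation_shift _ _ _ _ _, relaxation_shift _ _ _ _ _,
        h.reachable_relaxation htk.le hd e, h.coupled_relaxation htk hx hy hlx hly hd hdd e ?_⟩
      rintro ⟨⟨h1, h2⟩, h3⟩
      have := hTT e he h1 h2
      omega
    match n', hrelax, hTT with
    | none, _, _ => exact ⟨rfl, d, d', rfl, rfl, hd, hdd⟩
    | some (.leaf e), hrelax, _ => exact ⟨rfl, hrelax e rfl⟩
    | some (.relax e next), hrelax, _ => exact ⟨rfl, hrelax e rfl⟩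
    | some (.query q yes no), _, hTT =>
      refine ⟨?_, d, d', rfl, rfl, hd, hdd⟩
      have hans : q.answer (shift φ (hiddenWeights X k (extendLabels lab t x y))) (lift φ s d') =
          q.answer (shift φ (hiddenWeights X k lab)) (lift φ s d) := by
        by_cases hq : ∃ e, q = .edge e
        · obtain ⟨e, rfl⟩ := hq
          have := h.coupled_edge htk hx hy hlx hly hd hdd (u := e.fst) (v := e.snd)
            (by simp) (by
              rintro ⟨⟨h1, h2⟩, h3⟩
              have := hTT e rfl h1 h2
              omega)
          rw [answer_edge_shift, answer_edge_shift, decide_eq_decide]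
          simp only [hiddenWeights]
          omega
        · have hd0 := hd.nonneg htk.le
          refine hφ.answer_eq s (fun e => h.hiddenWeight_mem htk.le _ _)
            (fun e => (h.extend hx hy hlx hly).hiddenWeight_mem htk _ _)
            (fun v => ⟨hd0 v, hd.le_cap v⟩) (fun v => ?_) q (fun e he => hq ⟨e, he⟩)
          by_cases hvx : v = x
          · subst hvx
            have := mul_lt_cap_sub htk
            have := hd0 v
            have := hd.le_cap v
            have : 0 ≤ (t : ℤ) * k := by positivity
            rcases hdd.spoke with h | h <;> omega
          · rw [hdd.eq_of_ne v hvx]; exact ⟨hd0 v, hd.le_cap v⟩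
      simp only [step, hans]

end Extension

/-! ### The time until the next hub is improved -/

namespace DecisionTree

/-- The number of steps until the D-value of `c` is less than `b`. -/
noncomputable def improvementTime (s : V) (ℓ : Weights V) (c : V) (b : ℤ) (A : DecisionTree V) :
    ℕ∞ :=
  ⨅ i ∈ {i : ℕ | (run s ℓ A i).2 c < b}, (i : ℕ∞)

theorem improvementTime_le_iff {s : V} {ℓ : Weights V} {c : V} {b : ℤ} {A : DecisionTree V}
    {i : ℕ} : improvementTime s ℓ c b A ≤ i ↔ ∃ j ≤ i, (run s ℓ A j).2 c < b := by
  rw [← ENat.lt_natCast_add_one_iff, improvementTime]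
  simp only [iInf_lt_iff, Set.mem_ofPred_eq, exists_prop]
  refine exists_congr fun j => ?_
  rw [ENat.lt_natCast_add_one_iff, Nat.cast_le]
  tauto

end DecisionTree

open DecisionTree in
/-- The next hub `y` of the extended path is improved only after the edge `(x, y)` has been touched,
and this touch follows the improvement of `c`. Both the touch and the improvement of `c` are those
of the computation on the instance that does not know `x` and `y`. -/
theorem IsHiddenPath.exists_touched {X : Finset V} {s c x y : V} {t k : ℕ} {lab : V → Option ℕ}
    (h : IsHiddenPath X s t lab c) (htk : t < k) (hx : x ∈ X) (hy : y ∉ X) (hlx : lab x = none)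
    (hly : lab y = none) {φ : V → ℤ} (hφ : Separated φ (cap k)) (A : DecisionTree V) (i : ℕ)
    (hi : improvementTime s (shift φ (hiddenWeights X k (extendLabels lab t x y))) y
      (lift φ s (fun _ => cap k) y) A ≤ i) :
    ∃ j < i, improvementTime s (shift φ (hiddenWeights X k lab)) c
        (lift φ s (fun _ => cap k) c) A ≤ j ∧
      (touched (run s (shift φ (hiddenWeights X k lab)) A j).1).map (·.toProd) = some (x, y) := by
  rw [improvementTime_le_iff] at hi
  obtain ⟨i', hi', hlt⟩ := hi
  by_contra hcon
  push Not at hcon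
  obtain ⟨-, d, d', -, hrd', hd, hdd⟩ := h.coupled_run htk hx hy hlx hly hφ A i' (by
    intro j hj e he hex hey
    by_contra hjc
    refine hcon j (by omega) (improvementTime_le_iff.2 ⟨j, le_rfl, not_le.1 hjc⟩) ?_
    rw [he, Option.map_some, ← hex, ← hey])
  have hyx : y ≠ x := by rintro rfl; exact hy hx
  rw [hrd', lift, lift, hdd.eq_of_ne y hyx, hd.hub_none y hy hly] at hlt
  exact lt_irrefl _ hlt

/-- If the events in `F` happen at distinct times, none of them before time `a`, then at least half
of them happen no earlier than `a + 2 * H`, where `4 * H ≤ #F`. -/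
theorem card_mul_le_sum {β : Type*} (F : Finset β) (H : ℕ) (hF : 4 * H ≤ F.card)
    (a : ℕ∞) (b : β → ℕ∞) (g : ℕ → Option β)
    (h : ∀ p ∈ F, ∀ i : ℕ, b p ≤ i → ∃ j < i, a ≤ j ∧ g j = some p) :
    (F.card : ℕ∞) * (a + H) ≤ ∑ p ∈ F, b p := by
  classical
  cases a with
  | top =>
    have hb : ∀ p ∈ F, ⊤ + (H : ℕ∞) ≤ b p := by
      intro p hp
      by_contra hlt
      obtain ⟨i, hi⟩ := ENat.ne_top_iff_exists.1 (show b p ≠ ⊤ by rintro h; simp [h] at hlt)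
      obtain ⟨j, -, hj, -⟩ := h p hp i hi.ge
      simp at hj
    simpa using Finset.sum_le_sum hb
  | coe a =>
    let S := F.filter fun p => b p < (a + 2 * H : ℕ)
    have hS : S.card ≤ 2 * H := by
      have hex : ∀ p ∈ S, ∃ j ∈ Finset.Ico a (a + 2 * H), g j = some p := by
        intro p hp
        obtain ⟨hpF, hpb⟩ := Finset.mem_filter.1 hp
        obtain ⟨i, hi⟩ := ENat.ne_top_iff_exists.1 hpb.ne_top
        obtain ⟨j, hji, haj, hj⟩ := h p hpF i hi.ge
        rw [← hi] at hpb
        have h1 : i < a + 2 * H := by exact_mod_cast hpb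
        have h2 : a ≤ j := by exact_mod_cast haj
        exact ⟨j, Finset.mem_Ico.2 ⟨h2, by omega⟩, hj⟩
      choose! f hf hg using hex
      have hcard := Finset.card_le_card_of_injOn f hf (by
        intro p hp q hq hpq
        have := (hg p hp).symm.trans ((congrArg g hpq).trans (hg q hq))
        simpa using this)
      simpa using hcard
    have hb : ∀ p ∈ F, ((a + if b p < (a + 2 * H : ℕ) then 0 else 2 * H : ℕ) : ℕ∞) ≤ b p := by
      intro p hp
      split_ifs with hlt
      · obtain ⟨i, hi⟩ := ENat.ne_top_iff_exists.1 hlt.ne_top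
        obtain ⟨j, hji, haj, -⟩ := h p hp i hi.ge
        rw [← hi]
        have : a ≤ j := by exact_mod_cast haj
        exact_mod_cast (by omega : a + 0 ≤ i)
      · exact not_lt.1 hlt
    refine le_trans ?_ (Finset.sum_le_sum hb)
    have hcard : S.card + (F.filter fun p => ¬ b p < (a + 2 * H : ℕ)).card = F.card :=
      Finset.card_filter_add_card_filter_not _
    have hsum : ∑ p ∈ F, (a + if b p < (a + 2 * H : ℕ) then 0 else 2 * H) =
        F.card * a + (F.filter fun p => ¬ b p < (a + 2 * H : ℕ)).card * (2 * H) := by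
      rw [Finset.sum_add_distrib, Finset.sum_const, smul_eq_mul, Finset.sum_ite]
      simp
    have hle : F.card * (a + H) ≤ ∑ p ∈ F, (a + if b p < (a + 2 * H : ℕ) then 0 else 2 * H) := by
      rw [hsum]
      nlinarith
    exact_mod_cast hle

/-! ### Choosing the hidden path -/

/-- Some simple path along labelled vertices from `s` to `c` has reduced length `t * k`. -/
def HasPath (X : Finset V) (k : ℕ) (s : V) (t : ℕ) (lab : V → Option ℕ) (c : V) : Prop :=
  ∃ p : (⊤ : SimpleGraph V).Walk s c, p.IsPath ∧ (∀ v ∈ p.support, lab v ≠ none) ∧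
    walkLength (hiddenWeights X k lab) p = t * k

theorem IsHiddenPath.hasPath_extend {X : Finset V} {s c x y : V} {t k : ℕ} {lab : V → Option ℕ}
    (h : IsHiddenPath X s t lab c) (hx : x ∈ X) (hy : y ∉ X) (hlx : lab x = none)
    (hly : lab y = none) (hp : HasPath X k s t lab c) :
    HasPath X k s (t + 1) (extendLabels lab t x y) y := by
  obtain ⟨p, hp, hsup, hlen⟩ := hp
  have hxy : x ≠ y := by rintro rfl; exact hy hx
  have hcx : c ≠ x := by rintro rfl; exact h.end_notMem hx
  have hcy : c ≠ y := by rintro rfl; simp [h.lab_end] at hly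
  have hlabx : extendLabels lab t x y x = some t := by simp [extendLabels, hxy]
  have hlaby : extendLabels lab t x y y = some (t + 1) := by simp [extendLabels]
  have hxp : x ∉ p.support := fun h => hsup x h hlx
  have hyp : y ∉ p.support := fun h => hsup y h hly
  let h1 : (⊤ : SimpleGraph V).Adj c x := by simpa using hcx
  let h2 : (⊤ : SimpleGraph V).Adj x y := by simpa using hxy
  refine ⟨(p.concat h1).concat h2, ?_, ?_, ?_⟩
  · refine (hp.concat hxp h1).concat ?_ h2
    simp [SimpleGraph.Walk.support_concat, hyp, hxy.symm]
  · intro v hv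
    simp only [SimpleGraph.Walk.support_concat, List.mem_append,
      List.mem_singleton] at hv
    rcases hv with (hv | rfl) | rfl
    · have hvx : v ≠ x := by rintro rfl; exact hxp hv
      have hvy : v ≠ y := by rintro rfl; exact hyp hv
      rw [extendLabels_of_ne hvx hvy]
      exact hsup v hv
    · simp [hlabx]
    · simp [hlaby]
  · have hold : p.darts.map (hiddenWeights X k (extendLabels lab t x y)) =
        p.darts.map (hiddenWeights X k lab) := by
      refine List.map_congr_left fun e he => ?_
      have hfst := p.dart_fst_mem_support_of_mem_darts he
      have hsnd := p.dart_snd_mem_support_of_mem_darts he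
      exact h.hiddenWeight_extend hx hy hlx hly (fun h => hyp (h ▸ hfst))
        (fun h => hxp (h.2 ▸ hsnd)) (fun h => hxp (h.1 ▸ hfst))
    have hw1 : hiddenWeight X k (extendLabels lab t x y) c x = 0 := by
      simp [hiddenWeight, h.end_notMem, hx, hlabx, extendLabels_of_ne hcx hcy, h.lab_end]
    have hw2 : hiddenWeight X k (extendLabels lab t x y) x y = k := by
      simp [hiddenWeight, hx, hy, hlabx, hlaby]
    unfold walkLength at hlen ⊢
    simp only [SimpleGraph.Walk.darts_concat, List.concat_eq_append, List.map_append, hold,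
      List.sum_append, hlen, List.map_cons, List.map_nil, List.sum_cons, List.sum_nil]
    simp only [hiddenWeights, hw1, hw2]
    push_cast
    ring

theorem card_filter_extendLabels {S : Finset V} {lab : V → Option ℕ} {t : ℕ} {x y z : V}
    (hz : ∀ v ∈ S, v = x ∨ v = y → v = z) :
    (S.filter fun v => lab v = none).card ≤
      (S.filter fun v => extendLabels lab t x y v = none).card + 1 := by
  refine le_trans (Finset.card_le_card ?_) (Finset.card_insert_le z _)
  intro v hv
  obtain ⟨hvS, hl⟩ := Finset.mem_filter.1 hv
  by_cases hvz : v = z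
  · exact Finset.mem_insert.2 (Or.inl hvz)
  · have hvx : v ≠ x := fun h => hvz (hz v hvS (Or.inl h))
    have hvy : v ≠ y := fun h => hvz (hz v hvS (Or.inr h))
    refine Finset.mem_insert_of_mem (Finset.mem_filter.2 ⟨hvS, ?_⟩)
    rwa [extendLabels_of_ne hvx hvy]

open DecisionTree in
/-- The method of conditional expectations. A hidden path with `t` spokes whose end has expected
improvement time at least `t * h ^ 2` is extended by a free spoke `x` and a free hub `y`. For each
deterministic algorithm the improvement time grows by at least `h ^ 2` on average over all choices
of `(x, y)`, so some choice is good for the expectation over `R`. -/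
theorem exists_isHiddenPath [Fintype V] {X : Finset V} {s : V} (hs : s ∉ X) {h : ℕ}
    (hX : 4 * h ≤ X.card) (hXc : 4 * h + 1 ≤ Xᶜ.card) {φ : V → ℤ}
    (hφ : Separated φ (cap (2 * h))) (R : PMF (DecisionTree V)) (t : ℕ) (ht : t ≤ 2 * h) :
    ∃ lab c, IsHiddenPath X s t lab c ∧ HasPath X (2 * h) s t lab c ∧
      4 * h ≤ (X.filter fun v => lab v = none).card + t ∧
      4 * h ≤ (Xᶜ.filter fun v => lab v = none).card + t ∧
      ((t * h ^ 2 : ℕ) : ℝ≥0∞) ≤ ∑' A, R A * (improvementTime s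
        (shift φ (hiddenWeights X (2 * h) lab)) c (lift φ s (fun _ => cap (2 * h)) c) A : ℝ≥0∞) := by
  induction t with
  | zero =>
    let lab : V → Option ℕ := Function.update (fun _ => none) s (some 0)
    have hlab : ∀ v j, lab v = some j → v = s ∧ j = 0 := by
      intro v j hv
      by_cases hvs : v = s
      · subst hvs; simpa [lab, eq_comm] using hv
      · simp [lab, hvs] at hv
    have hlabs : lab s = some 0 := by simp [lab]
    refine ⟨lab, s, ⟨hs, hlabs, ?_, ?_, hs, hlabs, ?_⟩, ⟨.nil, by simp, ?_, ?_⟩, ?_, ?_, by simp⟩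
    · intro v hv j hj
      obtain ⟨rfl, -⟩ := hlab v j hj
      exact absurd hv hs
    · intro v _ j hj
      exact (hlab v j hj).2.le
    · intro v _ hj
      exact (hlab v 0 hj).1
    · simp [hlabs]
    · simp [walkLength]
    · rw [Finset.filter_true_of_mem]
      · exact hX
      · intro v hv
        have : v ≠ s := by rintro rfl; exact hs hv
        simp [lab, this]
    · have hsub : Xᶜ.erase s ⊆ Xᶜ.filter fun v => lab v = none := by
        intro v hv
        rw [Finset.mem_erase] at hv
        refine Finset.mem_filter.2 ⟨hv.2, ?_⟩
        simp [lab, hv.1]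
      have h1 := Finset.card_le_card hsub
      rw [Finset.card_erase_of_mem (by simpa using hs)] at h1
      omega
  | succ t ih =>
    obtain ⟨lab, c, hP, hpath, hcX, hcXc, hE⟩ := ih (by omega)
    have htk : t < 2 * h := by omega
    set F := (X.filter fun v => lab v = none) ×ˢ (Xᶜ.filter fun v => lab v = none) with hFdef
    have hF : ∀ p ∈ F, p.1 ∈ X ∧ p.2 ∉ X ∧ lab p.1 = none ∧ lab p.2 = none := by
      intro p hp
      simp only [hFdef, Finset.mem_product, Finset.mem_filter, Finset.mem_compl] at hp
      tauto
    have hcard : 4 * h ^ 2 ≤ F.card := by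
      rw [hFdef, Finset.card_product]
      calc 4 * h ^ 2 = (2 * h) * (2 * h) := by ring
        _ ≤ _ := Nat.mul_le_mul (by omega) (by omega)
    have hne : F.Nonempty := by
      rw [← Finset.card_pos]
      have : 0 < h := by omega
      have : 0 < h ^ 2 := by positivity
      omega
    let T : DecisionTree V → ℕ∞ := improvementTime s (shift φ (hiddenWeights X (2 * h) lab)) c
      (lift φ s (fun _ => cap (2 * h)) c)
    let T' : V × V → DecisionTree V → ℕ∞ := fun p => improvementTime s
      (shift φ (hiddenWeights X (2 * h) (extendLabels lab t p.1 p.2))) p.2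
      (lift φ s (fun _ => cap (2 * h)) p.2)
    have hsum : ∀ A, (F.card : ℕ∞) * (T A + (h ^ 2 : ℕ)) ≤ ∑ p ∈ F, T' p A := by
      intro A
      refine card_mul_le_sum F (h ^ 2) hcard _ _ (fun j => (touched (run s
        (shift φ (hiddenWeights X (2 * h) lab)) A j).1).map (·.toProd)) fun p hp i hi => ?_
      obtain ⟨hx, hy, hlx, hly⟩ := hF p hp
      exact hP.exists_touched htk hx hy hlx hly hφ A i hi
    have hsumE : ∀ A, (F.card : ℝ≥0∞) * ((T A : ℝ≥0∞) + (h ^ 2 : ℕ)) ≤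
        ∑ p ∈ F, (T' p A : ℝ≥0∞) := by
      intro A
      have := ENat.toENNReal_le.2 (hsum A)
      have hcoe : ((∑ p ∈ F, T' p A : ℕ∞) : ℝ≥0∞) = ∑ p ∈ F, (T' p A : ℝ≥0∞) :=
        map_sum ENat.toENNRealRingHom _ _
      rw [hcoe] at this
      simpa using this
    obtain ⟨p, hp, hle⟩ : ∃ p ∈ F, (((t + 1) * h ^ 2 : ℕ) : ℝ≥0∞) ≤
        ∑' A, R A * (T' p A : ℝ≥0∞) := by
      refine ENNReal.exists_le_of_sum_le hne ?_
      calc ∑ _p ∈ F, (((t + 1) * h ^ 2 : ℕ) : ℝ≥0∞)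
          = F.card * (((t * h ^ 2 : ℕ) : ℝ≥0∞) + (h ^ 2 : ℕ)) := by
            rw [Finset.sum_const, nsmul_eq_mul]; push_cast; ring
        _ ≤ F.card * (∑' A, R A * (T A : ℝ≥0∞) + ∑' A, R A * ((h ^ 2 : ℕ) : ℝ≥0∞)) := by
            rw [ENNReal.tsum_mul_right, R.tsum_coe, one_mul]
            gcongr
        _ = ∑' A, R A * (F.card * ((T A : ℝ≥0∞) + (h ^ 2 : ℕ))) := by
            rw [← ENNReal.tsum_add, ← ENNReal.tsum_mul_left]
            exact tsum_congr fun A => by ring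
        _ ≤ ∑' A, R A * ∑ p ∈ F, (T' p A : ℝ≥0∞) :=
            ENNReal.tsum_le_tsum fun A => by gcongr; exact hsumE A
        _ = ∑ p ∈ F, ∑' A, R A * (T' p A : ℝ≥0∞) := by
            rw [← Summable.tsum_finsetSum fun _ _ => ENNReal.summable]
            exact tsum_congr fun A => Finset.mul_sum _ _ _
    obtain ⟨hx, hy, hlx, hly⟩ := hF p hp
    refine ⟨extendLabels lab t p.1 p.2, p.2, hP.extend hx hy hlx hly,
      hP.hasPath_extend hx hy hlx hly hpath, ?_, ?_, hle⟩
    · have := card_filter_extendLabels (S := X) (lab := lab) (t := t) (x := p.1) (y := p.2)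
        (z := p.1) (by rintro v hv (h | rfl); exacts [h, absurd hv hy])
      omega
    · have := card_filter_extendLabels (S := Xᶜ) (lab := lab) (t := t) (x := p.1) (y := p.2)
        (z := p.2) (by
          rintro v hv (rfl | h)
          exacts [absurd hx (Finset.mem_compl.1 hv), h])
      omega

open DecisionTree in
/-- All D-values can be correct only after the end of the hidden path has been improved. -/
theorem HasPath.improvementTime_le {X : Finset V} {s c : V} {k : ℕ} {lab : V → Option ℕ}
    (hp : HasPath X k s k lab c) (hk : 0 < k) (φ : V → ℤ) (A : DecisionTree V) :
    improvementTime s (shift φ (hiddenWeights X k lab)) c (lift φ s (fun _ => cap k) c) A ≤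
      A.runningTime s (shift φ (hiddenWeights X k lab)) := by
  refine le_iInf₂ fun i hi => improvementTime_le_iff.2 ⟨i, le_rfl, ?_⟩
  obtain ⟨p, hp, -, hlen⟩ := hp
  have := (hi c).2 ⟨p, hp, rfl⟩
  rw [walkLength_shift, hlen] at this
  rw [run_snd, lift]
  have hk' : (0 : ℤ) < k := by exact_mod_cast hk
  have : (k : ℤ) * k < cap k := by unfold cap; nlinarith
  omega

/-! ### A separated potential -/

/-- The Erdős–Turán Sidon set `2 * p * i + (i ^ 2 mod p)`, where `p > n` is prime. -/
theorem exists_sidon (n : ℕ) (hn : 2 ≤ n) : ∃ a : Fin n → ℤ,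
    (∀ i, 0 ≤ a i ∧ a i ≤ 4 * n ^ 2) ∧
    ∀ u v x y : Fin n, u ≠ v → a v - a u = a y - a x → u = x ∧ v = y := by
  obtain ⟨p, hp, hnp, hp2⟩ := Nat.exists_prime_lt_and_le_two_mul n (by omega)
  have : Fact p.Prime := ⟨hp⟩
  refine ⟨fun i => ((2 * p * i + i ^ 2 % p : ℕ) : ℤ), fun i => ⟨by positivity, ?_⟩, ?_⟩
  · have h1 : (i : ℕ) ^ 2 % p < p := Nat.mod_lt _ hp.pos
    have h2 : (i : ℕ) + 1 ≤ n := i.2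
    have : 2 * p * i + i ^ 2 % p ≤ 4 * n ^ 2 := by nlinarith
    simp only
    exact_mod_cast this
  · intro u v x y huv h
    have hsum : 2 * p * v + (v : ℕ) ^ 2 % p + (2 * p * x + (x : ℕ) ^ 2 % p) =
        2 * p * y + (y : ℕ) ^ 2 % p + (2 * p * u + (u : ℕ) ^ 2 % p) := by
      zify
      push_cast at h
      linarith
    have hv := Nat.mod_lt ((v : ℕ) ^ 2) hp.pos
    have hx := Nat.mod_lt ((x : ℕ) ^ 2) hp.pos
    have hy := Nat.mod_lt ((y : ℕ) ^ 2) hp.pos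
    have hu := Nat.mod_lt ((u : ℕ) ^ 2) hp.pos
    -- The residues sum to less than `2 * p`, so the multiples of `2 * p` agree.
    have hlin : (v : ℕ) + x = y + u := by
      have e1 : 2 * p * ((v : ℕ) + x) + ((v : ℕ) ^ 2 % p + (x : ℕ) ^ 2 % p) =
          2 * p * ((y : ℕ) + u) + ((y : ℕ) ^ 2 % p + (u : ℕ) ^ 2 % p) := by linarith
      have e2 := congrArg (· / (2 * p)) e1
      simpa only [Nat.mul_add_div (show 0 < 2 * p by omega),
        Nat.div_eq_of_lt (show (v : ℕ) ^ 2 % p + (x : ℕ) ^ 2 % p < 2 * p by omega),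
        Nat.div_eq_of_lt (show (y : ℕ) ^ 2 % p + (u : ℕ) ^ 2 % p < 2 * p by omega),
        add_zero] using e2
    have hsq : (v : ℕ) ^ 2 % p + (x : ℕ) ^ 2 % p = (y : ℕ) ^ 2 % p + (u : ℕ) ^ 2 % p := by
      have e1 : 2 * p * ((v : ℕ) + x) = 2 * p * ((y : ℕ) + u) := by rw [hlin]
      linarith
    have hsqZ : ((v : ℕ) : ZMod p) ^ 2 + ((x : ℕ) : ZMod p) ^ 2 =
        ((y : ℕ) : ZMod p) ^ 2 + ((u : ℕ) : ZMod p) ^ 2 := by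
      have := congrArg (Nat.cast : ℕ → ZMod p) hsq
      simpa using this
    have hlinZ : ((v : ℕ) : ZMod p) + ((x : ℕ) : ZMod p) =
        ((y : ℕ) : ZMod p) + ((u : ℕ) : ZMod p) := by exact_mod_cast congrArg _ hlin
    have hinj : ∀ i j : Fin n, ((i : ℕ) : ZMod p) = ((j : ℕ) : ZMod p) → i = j := by
      intro i j hij
      rw [ZMod.natCast_eq_natCast_iff] at hij
      exact Fin.ext (hij.eq_of_lt_of_lt (i.2.trans hnp) (j.2.trans hnp))
    have h2 : (2 : ZMod p) ≠ 0 := by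
      intro h
      have : ((2 : ℕ) : ZMod p) = 0 := by exact_mod_cast h
      rw [ZMod.natCast_eq_zero_iff] at this
      have := Nat.le_of_dvd (by norm_num) this
      omega
    have hprod : (((v : ℕ) : ZMod p) - ((u : ℕ) : ZMod p)) *
        (2 * (((v : ℕ) : ZMod p) - ((y : ℕ) : ZMod p))) = 0 := by
      linear_combination hsqZ +
        (((v : ℕ) : ZMod p) - ((u : ℕ) : ZMod p) - ((y : ℕ) : ZMod p) - ((x : ℕ) : ZMod p)) * hlinZ
    have hvy : v = y := by
      rcases mul_eq_zero.1 hprod with h | h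
      · exact absurd (hinj _ _ (sub_eq_zero.1 h)).symm huv
      · exact hinj _ _ (sub_eq_zero.1 ((mul_eq_zero.1 h).resolve_left h2))
    subst hvy
    exact ⟨Fin.ext (by omega), rfl⟩

theorem exists_separated (n : ℕ) (hn : 2 ≤ n) (K : ℕ) : ∃ φ : Fin n → ℤ, Separated φ K ∧
    ∀ u v, |φ v - φ u| ≤ (K + 1) * (4 * n ^ 2) := by
  obtain ⟨a, ha, hsidon⟩ := exists_sidon n hn
  have hgap : ∀ z : ℤ, z ≠ 0 → (K : ℤ) < |(K + 1) * z| := by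
    intro z hz
    have h1 : 1 ≤ |z| := Int.one_le_abs hz
    rw [abs_mul, abs_of_nonneg (by positivity : (0 : ℤ) ≤ K + 1)]
    nlinarith
  refine ⟨fun v => (K + 1) * a v, ⟨fun e f hef => ?_, fun u v huv => ?_⟩, fun u v => ?_⟩
  · have h := hgap ((a e.snd - a e.fst) - (a f.snd - a f.fst)) fun h0 => hef (by
      obtain ⟨h1, h2⟩ := hsidon e.fst e.snd f.fst f.snd (by simp) (by omega)
      exact SimpleGraph.Dart.ext _ _ (Prod.ext h1 h2))
    convert h using 2
    ring
  · have h := hgap (a u - a v) fun h0 => huv (hsidon v u u u huv.symm (by omega)).1.symm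
    convert h using 2
    ring
  · rw [← mul_sub, abs_mul, abs_of_nonneg (by positivity : (0 : ℤ) ≤ K + 1)]
    refine mul_le_mul_of_nonneg_left ?_ (by positivity)
    have := ha u
    have := ha v
    rw [abs_le]
    constructor <;> omega

/-! ### The lower bound -/

theorem IsInput.mono {V : Type*} {W W' : ℕ} (h : W ≤ W') {ℓ : Weights V} (hℓ : IsInput W ℓ) :
    IsInput W' ℓ :=
  ⟨hℓ.noNegativeCycle, fun e => (hℓ.abs_le e).trans (by exact_mod_cast h)⟩

theorem expectedRunningTime_pure (s : V) (ℓ : Weights V) (A : DecisionTree V) :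
    DecisionTree.expectedRunningTime s ℓ (PMF.pure A) = (A.runningTime s ℓ : ℝ≥0∞) := by
  classical
  rw [DecisionTree.expectedRunningTime, tsum_eq_single A]
  · simp
  · intro B hB
    simp [PMF.pure_apply, hB]

/-- The lower bound holds for every probability distribution on decision trees: a computation that
never reaches the correct D-values counts as infinitely long. -/
theorem exists_isInput_le_expectedRunningTime (n : ℕ) (hn : 16 ≤ n) (s : Fin n)
    (R : PMF (DecisionTree (Fin n))) : ∃ ℓ : Weights (Fin n), IsInput (9 * n ^ 4) ℓ ∧
      ((1 / 2048 : ℝ≥0) : ℝ≥0∞) * (n : ℝ≥0∞) ^ 3 ≤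
        DecisionTree.expectedRunningTime s ℓ R := by
  obtain ⟨h, hh⟩ : ∃ h, h = (n - 1) / 8 := ⟨_, rfl⟩
  have hh1 : 8 * h + 1 ≤ n := by omega
  have hh2 : n ≤ 16 * h := by omega
  obtain ⟨X, hXs, hX⟩ := Finset.exists_subset_card_eq
    (s := (Finset.univ : Finset (Fin n)).erase s) (n := 4 * h) (by simp; omega)
  have hs : s ∉ X := fun h => by simpa using hXs h
  have hXc : 4 * h + 1 ≤ Xᶜ.card := by
    rw [Finset.card_compl, Fintype.card_fin]; omega
  obtain ⟨φ, hφ, hφb⟩ := exists_separated n (by omega) (2 * h * (2 * h + 1))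
  have hcap : ((2 * h * (2 * h + 1) : ℕ) : ℤ) = cap (2 * h) := by simp [cap]
  obtain ⟨lab, c, hP, hpath, -, -, hE⟩ := exists_isHiddenPath hs hX.ge hXc (hcap ▸ hφ) R _ le_rfl
  have hw := hP.hiddenWeight_mem (k := 2 * h) le_rfl
  refine ⟨shift φ (hiddenWeights X (2 * h) lab), ⟨fun v p => ?_, fun e => ?_⟩, ?_⟩
  · rw [walkLength_shift]
    have := walkLength_nonneg (w := hiddenWeights X (2 * h) lab) (fun e => (hw _ _).1) p
    omega
  · have h1 := hw e.fst e.snd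
    have h2 := hφb e.fst e.snd
    have h3 : cap (2 * h) ≤ n ^ 2 := by
      rw [← hcap]
      have : 2 * h * (2 * h + 1) ≤ n * n := Nat.mul_le_mul (by omega) (by omega)
      rw [sq]
      exact_mod_cast this
    rw [hcap] at h2
    have h4 : (cap (2 * h) + 1) * (4 * (n : ℤ) ^ 2) ≤ (n ^ 2 + 1) * (4 * n ^ 2) := by gcongr
    have h5 : (1 : ℤ) ≤ n ^ 2 := by
      have : 1 ≤ n ^ 2 := Nat.one_le_pow _ _ (by omega)
      exact_mod_cast this
    calc |shift φ (hiddenWeights X (2 * h) lab) e|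
        ≤ |hiddenWeight X (2 * h) lab e.fst e.snd| + |φ e.snd - φ e.fst| := abs_add_le _ _
      _ ≤ n ^ 2 + (n ^ 2 + 1) * (4 * n ^ 2) := by
          rw [abs_of_nonneg h1.1]; linarith
      _ ≤ ((9 * n ^ 4 : ℕ) : ℤ) := by push_cast; nlinarith
  · calc ((1 / 2048 : ℝ≥0) : ℝ≥0∞) * (n : ℝ≥0∞) ^ 3
        ≤ ((2 * h * h ^ 2 : ℕ) : ℝ≥0∞) := by
          have h6 : (n : ℝ≥0) ≤ 16 * h := by exact_mod_cast hh2
          have : (1 / 2048 : ℝ≥0) * (n : ℝ≥0) ^ 3 ≤ ((2 * h * h ^ 2 : ℕ) : ℝ≥0) := by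
            calc (1 / 2048 : ℝ≥0) * (n : ℝ≥0) ^ 3 ≤ (1 / 2048 : ℝ≥0) * (16 * h) ^ 3 := by gcongr
              _ = ((2 * h * h ^ 2 : ℕ) : ℝ≥0) := by push_cast; ring
          exact_mod_cast ENNReal.coe_le_coe.2 this
      _ ≤ _ := hE
      _ ≤ _ := ENNReal.tsum_le_tsum fun A => by
          gcongr
          exact_mod_cast hpath.improvementTime_le (by omega) φ A

end QueryRelaxation

theorem theorem2 :
    (∃ (c : ℝ≥0) (C N : ℕ), 0 < c ∧ ∀ n : ℕ, N ≤ n →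
      ∀ (s : Fin n) (A : QueryRelaxation.DecisionTree (Fin n)), A.IsCorrect s (C * n ^ 4) →
        ∃ ℓ : QueryRelaxation.Weights (Fin n), QueryRelaxation.IsInput (C * n ^ 4) ℓ ∧
          (c : ℝ≥0∞) * (n : ℝ≥0∞) ^ 3 ≤ (A.runningTime s ℓ : ℝ≥0∞)) ∧
    (∃ (c : ℝ≥0) (C N : ℕ), 0 < c ∧ ∀ n : ℕ, N ≤ n →
      ∀ (s : Fin n) (R : PMF (QueryRelaxation.DecisionTree (Fin n))),
        (∀ A ∈ R.support, A.IsCorrect s (C * n ^ 5)) →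
        ∃ ℓ : QueryRelaxation.Weights (Fin n), QueryRelaxation.IsInput (C * n ^ 5) ℓ ∧
          (c : ℝ≥0∞) * (n : ℝ≥0∞) ^ 3 ≤
            QueryRelaxation.DecisionTree.expectedRunningTime s ℓ R) := by
  refine ⟨⟨1 / 2048, 9, 16, by norm_num, fun n hn s A _ => ?_⟩,
    ⟨1 / 2048, 9, 16, by norm_num, fun n hn s R _ => ?_⟩⟩
  · obtain ⟨ℓ, hℓ, hle⟩ :=
      QueryRelaxation.exists_isInput_le_expectedRunningTime n hn s (PMF.pure A)
    exact ⟨ℓ, hℓ, by rwa [QueryRelaxation.expectedRunningTime_pure] at hle⟩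
  · obtain ⟨ℓ, hℓ, hle⟩ := QueryRelaxation.exists_isInput_le_expectedRunningTime n hn s R
    exact ⟨ℓ, hℓ.mono (Nat.mul_le_mul_left _ (Nat.pow_le_pow_right (by omega) (by norm_num))), hle⟩
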